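/- For Boolean $n\times n$ matrices $X$ (given to Alice) and $Y$ (given to Bob), let $X\wedge Y$ be their entrywise AND, let $\mathrm{DET}_n(X,Y)=\det(X\wedge Y)\in\mathbb{Z}$ be the integer determinant, and let $\mathrm{DET}_n^{(2)}(X,Y)\in\{0,1\}$ indicate whether $\det(X\wedge Y)\equiv 0 \pmod 2$. For a two-party problem $f$ let $Q_2(f)$ be the minimum number of qubits communicated by a quantum protocol without prior entanglement that computes $f$ with error probability at most $1/3$ on every input, and let $Q_2^*(f)$ be the same minimum when Alice and Bob may start with an arbitrary (input-independent) shared entangled state on finitely many qubits. (In a protocol, the parties apply input-dependent local operations with ancillas and send qubits one at a time in an order that does not depend on the inputs; at the end one party measures and outputs the answer.) **Theorem.** $Q_2(\mathrm{DET}_n)\ge\Omega(n^2)$, and this holds even modulo $2$ and even with unlimited prior entanglement. That is, there are a constant $c>0$ and an $N\in\mathbb{N}$ such that for all $n\ge N$ each of $$Q_2(\mathrm{DET}_n),\quad Q_2(\mathrm{DET}_n^{(2)}),\quad Q_2^*(\mathrm{DET}_n),\quad Q_2^*(\mathrm{DET}_n^{(2)})$$ is at least $c\,n^2$. -/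

import Mathlib

open scoped Matrix NNReal ENNReal

/-- Computational basis labels of a register of `k` qubits. -/
abbrev QBits (k : ℕ) : Type := Fin k → Bool

/-- An isometry from `m` qubits into `k` qubits, as a matrix in the computational basis.
This covers unitary operations and the adjoining of fresh ancilla qubits (hence also private coins
and, by deferring them to the end, intermediate measurements). -/
structure QIsometry (m k : ℕ) where
  mat : Matrix (QBits k) (QBits m) ℂ
  isometry : matᴴ * mat = 1

/-- Amplitudes of a bipartite pure state with `a` qubits held by Alice and `b` held by Bob:
`ψ u v` is the amplitude of `|u⟩ ⊗ |v⟩`. -/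
abbrev QAmp (a b : ℕ) : Type := Matrix (QBits a) (QBits b) ℂ

/-- A two-party quantum communication protocol with inputs `x : X` (Alice), `y : Y` (Bob) and
outputs in `R`, to be run when Alice holds `a` qubits and Bob holds `b` qubits.
In a sending step the sender applies an isometry, depending on the sender's own input only, to the
sender's register and hands qubit number `0` of the result to the other party.
At the end one of the parties applies an isometry to the own register, measures it in the
computational basis, and computes the output from the own input and the measurement outcome. -/
inductive QProtocol (X Y R : Type) : ℕ → ℕ → Type
  | aliceOutputs {a b : ℕ} (k : ℕ) (V : X → QIsometry a k) (g : X → QBits k → R) :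
      QProtocol X Y R a b
  | bobOutputs {a b : ℕ} (k : ℕ) (V : Y → QIsometry b k) (g : Y → QBits k → R) :
      QProtocol X Y R a b
  | aliceSends {a b : ℕ} (a' : ℕ) (U : X → QIsometry a (a' + 1))
      (rest : QProtocol X Y R a' (b + 1)) : QProtocol X Y R a b
  | bobSends {a b : ℕ} (b' : ℕ) (U : Y → QIsometry b (b' + 1))
      (rest : QProtocol X Y R (a + 1) b') : QProtocol X Y R a b

namespace QProtocol

variable {X Y R : Type}

/-- The number of qubits communicated. -/
def cost : {a b : ℕ} → QProtocol X Y R a b → ℕ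
  | _, _, aliceOutputs _ _ _ => 0
  | _, _, bobOutputs _ _ _ => 0
  | _, _, aliceSends _ _ rest => rest.cost + 1
  | _, _, bobSends _ _ rest => rest.cost + 1

open Classical in
/-- The probability that the protocol, started in the state `ψ` and run on inputs `x`, `y`,
outputs `r`. An operation `U` of Alice turns `ψ` into `(U ⊗ 1) ψ = U * ψ`, and an operation `V`
of Bob turns it into `(1 ⊗ V) ψ = ψ * Vᵀ`. A transmitted qubit leaves the sender's register and
becomes qubit number `0` of the receiver's register. -/
noncomputable def outputProb (x : X) (y : Y) (r : R) :
    {a b : ℕ} → QProtocol X Y R a b → QAmp a b → ℝ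
  | _, _, aliceOutputs _ V g, ψ =>
      ∑ u, ∑ v, if g x u = r then ‖((V x).mat * ψ) u v‖ ^ 2 else 0
  | _, _, bobOutputs _ V g, ψ =>
      ∑ u, ∑ v, if g y v = r then ‖(ψ * (V y).matᵀ) u v‖ ^ 2 else 0
  | _, _, aliceSends _ U rest, ψ =>
      outputProb x y r rest
        (Matrix.of fun u v => ((U x).mat * ψ) (Fin.cons (v 0) u) (Fin.tail v))
  | _, _, bobSends _ U rest, ψ =>
      outputProb x y r rest
        (Matrix.of fun u v => (ψ * (U y).matᵀ) (Fin.tail u) (Fin.cons (u 0) v))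

/-- Started in the state `ψ`, the protocol computes `f` with error probability at most `1/3`
on every input. -/
def Computes {a b : ℕ} (P : QProtocol X Y R a b) (ψ : QAmp a b) (f : X → Y → R) : Prop :=
  ∀ x y, 2 / 3 ≤ P.outputProb x y (f x y) ψ

end QProtocol

/-- `Q₂(f)`: the least number of qubits communicated by a protocol without prior entanglement that
computes `f` with error at most `1/3`. The parties start with no qubits at all (the state with the
single amplitude `1`); workspace is adjoined locally by the isometries. -/
noncomputable def quantumCC {X Y R : Type} (f : X → Y → R) : ℕ∞ :=
  ⨅ (P : QProtocol X Y R 0 0) (_ : P.Computes (Matrix.of fun _ _ => 1) f), (P.cost : ℕ∞)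

/-- `Q₂*(f)`: the same with unlimited prior entanglement, that is, the parties may start with an
arbitrary bipartite unit vector (independent of the inputs) on any finite numbers of qubits. -/
noncomputable def quantumCCEntangled {X Y R : Type} (f : X → Y → R) : ℕ∞ :=
  ⨅ (a : ℕ) (b : ℕ) (ψ : QAmp a b) (_ : ∑ u, ∑ v, ‖ψ u v‖ ^ 2 = 1)
    (P : QProtocol X Y R a b) (_ : P.Computes ψ f), (P.cost : ℕ∞)

/-- The problem `DET_n`: the integer determinant of the entrywise AND of two Boolean matrices. -/
def detAnd (n : ℕ) (X Y : Matrix (Fin n) (Fin n) Bool) : ℤ :=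
  (Matrix.of fun i j => if X i j && Y i j then (1 : ℤ) else 0).det

/-- The problem of deciding whether `det (X ∧ Y)` equals `0` modulo `2`. -/
def detAndEven (n : ℕ) (X Y : Matrix (Fin n) (Fin n) Bool) : Bool :=
  decide (detAnd n X Y ≡ 0 [ZMOD 2])

/-! The inner product mod 2 of `m²`-bit strings reduces to the parity of `det (X ∧ Y)`: a Boolean
matrix of size about `2m` has determinant `∑ z k`, and its AND with a second such matrix replaces
`z` by `x ∧ y` (`sumGadget_and`, `det_sumGadget`). Hence quadratic hardness of the inner product
suffices.

The latter is the `γ₂` (discrepancy) method. After `q` qubits the state is a sum of `2^q` terms `A i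
x * ψ * C i y` with contractions `A i x`, `C i y`, one for each string of transmitted bits. The
expected `±1` output is quadratic in the state, so it splits into `4^q` inner products of a vector
depending on `x` with one depending on `y`, both in the unit ball. Each correlates with a matrix `H`
by at most `‖H‖ √(|S| |T|)` (`norm_sum_mul_inner_le`), whereas correctness forces correlation at
least `|S| |T| / 3`. For the Hadamard matrix on `k` bits, `‖H‖² ≤ 2^k`, so `2^k ≤ 9 · 16^q`. The
start `ψ` is an arbitrary unit vector, so entanglement does not help. -/

/-! ### Frobenius norm, operator norm and the dual `γ₂` bound. -/

section FrobeniusBounds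

set_option linter.unusedSectionVars false

open scoped Matrix.Norms.L2Operator

variable {p q r : Type} [Fintype p] [Fintype q] [Fintype r]

/-- The square of the Frobenius norm. -/
noncomputable def frobSq (ψ : Matrix p q ℂ) : ℝ := ∑ u, ∑ v, ‖ψ u v‖ ^ 2

theorem frobSq_nonneg (ψ : Matrix p q ℂ) : 0 ≤ frobSq ψ := by
  unfold frobSq; positivity

theorem frobSq_transpose (ψ : Matrix p q ℂ) : frobSq ψᵀ = frobSq ψ := by
  simp only [frobSq, Matrix.transpose_apply]
  exact Finset.sum_comm

theorem frobSq_conjTranspose (ψ : Matrix p q ℂ) : frobSq ψᴴ = frobSq ψ := by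
  simp only [frobSq, Matrix.conjTranspose_apply, norm_star]
  exact Finset.sum_comm

theorem frobSq_eq_trace (ψ : Matrix p q ℂ) : (frobSq ψ : ℂ) = (ψᴴ * ψ).trace := by
  simp only [frobSq, Matrix.trace, Matrix.diag, Matrix.mul_apply, Matrix.conjTranspose_apply,
    Complex.ofReal_sum, Complex.ofReal_pow]
  rw [Finset.sum_comm]
  refine Finset.sum_congr rfl fun v _ => Finset.sum_congr rfl fun u _ => ?_
  exact (Complex.conj_mul' _).symm

theorem frobSq_mul_of_isometry [DecidableEq p] {U : Matrix q p ℂ} (hU : Uᴴ * U = 1)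
    (ψ : Matrix p r ℂ) : frobSq (U * ψ) = frobSq ψ := by
  have h : (frobSq (U * ψ) : ℂ) = frobSq ψ := by
    rw [frobSq_eq_trace, frobSq_eq_trace, Matrix.conjTranspose_mul, Matrix.mul_assoc,
      ← Matrix.mul_assoc Uᴴ, hU, Matrix.one_mul]
  exact_mod_cast h

theorem frobSq_mul_transpose_of_isometry [DecidableEq p] {U : Matrix q p ℂ} (hU : Uᴴ * U = 1)
    (ψ : Matrix r p ℂ) : frobSq (ψ * Uᵀ) = frobSq ψ := by
  rw [← frobSq_transpose, Matrix.transpose_mul, Matrix.transpose_transpose,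
    frobSq_mul_of_isometry hU, frobSq_transpose]

variable [DecidableEq p] [DecidableEq q] [DecidableEq r]

theorem l2_opNorm_le_one_of_isometry {U : Matrix q p ℂ} (hU : Uᴴ * U = 1) : ‖U‖ ≤ 1 := by
  have h := Matrix.l2_opNorm_conjTranspose_mul_self U
  rw [hU] at h
  -- Equality fails when `p` is empty.
  have h1 : ‖(1 : Matrix p p ℂ)‖ ≤ 1 := by
    rw [← Matrix.diagonal_one, Matrix.l2_opNorm_diagonal]
    exact (pi_norm_le_iff_of_nonneg zero_le_one).2 fun _ => by simp
  nlinarith [norm_nonneg U]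

theorem frobSq_mul_le (A : Matrix q p ℂ) (ψ : Matrix p r ℂ) :
    frobSq (A * ψ) ≤ ‖A‖ ^ 2 * frobSq ψ := by
  rw [← frobSq_transpose (A * ψ), ← frobSq_transpose ψ]
  unfold frobSq
  rw [Finset.mul_sum]
  refine Finset.sum_le_sum fun v _ => ?_
  have h := Matrix.l2_opNorm_mulVec A (WithLp.toLp 2 fun u => ψ u v)
  have h2 := pow_le_pow_left₀ (norm_nonneg _) h 2
  rw [mul_pow, EuclideanSpace.norm_sq_eq, EuclideanSpace.norm_sq_eq] at h2
  simpa [Matrix.mul_apply, Matrix.mulVec, dotProduct] using h2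

theorem l2_opNorm_le_one_of_coisometry {U : Matrix p q ℂ} (hU : U * Uᴴ = 1) : ‖U‖ ≤ 1 := by
  rw [← Matrix.l2_opNorm_conjTranspose]
  exact l2_opNorm_le_one_of_isometry (by rwa [Matrix.conjTranspose_conjTranspose])

theorem l2_opNorm_transpose_le_one_of_isometry {U : Matrix q p ℂ} (hU : Uᴴ * U = 1) :
    ‖Uᵀ‖ ≤ 1 := by
  refine l2_opNorm_le_one_of_coisometry ?_
  have h := congrArg Matrix.transpose hU
  rwa [Matrix.transpose_mul, Matrix.transpose_one] at h

theorem frobSq_mul_le' (ψ : Matrix r p ℂ) (A : Matrix p q ℂ) :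
    frobSq (ψ * A) ≤ ‖A‖ ^ 2 * frobSq ψ := by
  have h := frobSq_mul_le Aᴴ ψᴴ
  rwa [← Matrix.conjTranspose_mul, frobSq_conjTranspose, frobSq_conjTranspose,
    Matrix.l2_opNorm_conjTranspose] at h

theorem norm_trace_conjTranspose_mul_le (a b : Matrix p q ℂ) :
    ‖(aᴴ * b).trace‖ ^ 2 ≤ frobSq a * frobSq b := by
  have h1 : ‖(aᴴ * b).trace‖ ≤ ∑ w : p × q, ‖a w.1 w.2‖ * ‖b w.1 w.2‖ := by
    rw [Fintype.sum_prod_type, Finset.sum_comm]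
    simp only [Matrix.trace, Matrix.diag, Matrix.mul_apply, Matrix.conjTranspose_apply]
    refine (norm_sum_le _ _).trans (Finset.sum_le_sum fun v _ => ?_)
    refine (norm_sum_le _ _).trans (Finset.sum_le_sum fun u _ => ?_)
    simp
  have h2 := Finset.sum_mul_sq_le_sq_mul_sq Finset.univ
    (fun w : p × q => ‖a w.1 w.2‖) (fun w : p × q => ‖b w.1 w.2‖)
  simp only [Fintype.sum_prod_type] at h1 h2
  exact (pow_le_pow_left₀ (norm_nonneg _) h1 2).trans h2

/-- The dual-`γ₂` bound: a matrix of inner products of vectors in the unit ball correlates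
with `H` by at most `‖H‖ √(|S| |T|)`. -/
theorem norm_sum_mul_inner_le {S T : Type} [Fintype S] [Fintype T] [DecidableEq S] [DecidableEq T]
    (H : Matrix S T ℂ) (a : S → Matrix p q ℂ) (b : T → Matrix p q ℂ)
    (ha : ∀ x, frobSq (a x) ≤ 1) (hb : ∀ y, frobSq (b y) ≤ 1) :
    ‖∑ x, ∑ y, H x y * ((a x)ᴴ * b y).trace‖ ^ 2 ≤
      ‖H‖ ^ 2 * (Fintype.card S * Fintype.card T) := by
  -- With the vectors stacked as rows, the sum is the Frobenius pairing of `α` with `H * β`, and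
  -- Cauchy–Schwarz applies.
  let α : Matrix S (p × q) ℂ := Matrix.of fun x w => a x w.1 w.2
  let β : Matrix T (p × q) ℂ := Matrix.of fun y w => b y w.1 w.2
  have hα : frobSq α ≤ Fintype.card S := by
    have : frobSq α = ∑ x, frobSq (a x) := by
      simp only [frobSq, α, Matrix.of_apply, Fintype.sum_prod_type]
    rw [this]
    exact (Finset.sum_le_sum fun x _ => ha x).trans (by simp)
  have hβ : frobSq β ≤ Fintype.card T := by
    have : frobSq β = ∑ x, frobSq (b x) := by
      simp only [frobSq, β, Matrix.of_apply, Fintype.sum_prod_type]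
    rw [this]
    exact (Finset.sum_le_sum fun x _ => hb x).trans (by simp)
  have hsum : ∑ x, ∑ y, H x y * ((a x)ᴴ * b y).trace = (αᴴ * (H * β)).trace := by
    have e : ∀ x y, ((a x)ᴴ * b y).trace = ∑ w, star (α x w) * β y w := by
      intro x y
      rw [Fintype.sum_prod_type, Finset.sum_comm]
      simp [Matrix.trace, Matrix.mul_apply, α, β]
    simp only [e]
    simp only [Matrix.trace, Matrix.diag, Matrix.mul_apply, Matrix.conjTranspose_apply,
      Finset.mul_sum]
    calc _ = ∑ x, ∑ w, ∑ y, star (α x w) * (H x y * β y w) := by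
          refine Finset.sum_congr rfl fun x _ => ?_
          rw [Finset.sum_comm]
          refine Finset.sum_congr rfl fun w _ => Finset.sum_congr rfl fun y _ => ?_
          ring
      _ = _ := Finset.sum_comm
  rw [hsum]
  calc _ ≤ frobSq α * frobSq (H * β) := norm_trace_conjTranspose_mul_le _ _
    _ ≤ Fintype.card S * (‖H‖ ^ 2 * Fintype.card T) := by
        refine mul_le_mul hα ((frobSq_mul_le _ _).trans ?_) (frobSq_nonneg _) (by positivity)
        gcongr
    _ = _ := by ring

end FrobeniusBounds

/-! ### Sending a qubit as a sum of two local operations. -/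

section TransmittedQubit

/-- The matrix of `⟨s|` acting on qubit number `0`. -/
noncomputable def qubitBra (s : Bool) (k : ℕ) : Matrix (QBits k) (QBits (k + 1)) ℂ :=
  Matrix.of fun u w => if w = Fin.cons s u then 1 else 0

theorem qubitBra_mul {q : Type} (s : Bool) {k : ℕ} (M : Matrix (QBits (k + 1)) q ℂ)
    (u : QBits k) (v : q) : (qubitBra s k * M) u v = M (Fin.cons s u) v := by
  simp [qubitBra, Matrix.mul_apply]

theorem mul_qubitBra_conjTranspose {q : Type} (s : Bool) {k : ℕ} (M : Matrix q (QBits (k + 1)) ℂ)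
    (u : q) (v : QBits k) : (M * (qubitBra s k)ᴴ) u v = M u (Fin.cons s v) := by
  simp [qubitBra, Matrix.mul_apply, apply_ite]

theorem mul_qubitBra {q : Type} (s : Bool) {k : ℕ} (M : Matrix q (QBits k) ℂ)
    (u : q) (v : QBits (k + 1)) :
    (M * qubitBra s k) u v = if v 0 = s then M u (Fin.tail v) else 0 := by
  have e : ∀ w : QBits k, v = Fin.cons s w ↔ v 0 = s ∧ Fin.tail v = w := by
    intro w
    constructor
    · rintro rfl; simp
    · rintro ⟨rfl, rfl⟩; simp
  by_cases h : v 0 = s <;> simp [qubitBra, Matrix.mul_apply, e, h]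

theorem qubitBra_conjTranspose_mul {q : Type} (s : Bool) {k : ℕ} (M : Matrix (QBits k) q ℂ)
    (u : QBits (k + 1)) (v : q) :
    ((qubitBra s k)ᴴ * M) u v = if u 0 = s then M (Fin.tail u) v else 0 := by
  have h := mul_qubitBra s Mᴴ v u
  rw [← Matrix.conjTranspose_conjTranspose M, ← Matrix.conjTranspose_mul,
    Matrix.conjTranspose_apply, h]
  by_cases h : u 0 = s <;> simp [h]

theorem qubitBra_coisometry (s : Bool) (k : ℕ) : qubitBra s k * (qubitBra s k)ᴴ = 1 := by
  ext u v
  rw [qubitBra_mul, Matrix.conjTranspose_apply]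
  simp only [qubitBra, Matrix.of_apply, Matrix.one_apply, Fin.cons_right_injective _ |>.eq_iff,
    apply_ite star, star_one, star_zero]

/-- The state after qubit number `0` of the left register has moved to the right one. -/
noncomputable def sendRight {a b : ℕ} (φ : QAmp (a + 1) b) : QAmp a (b + 1) :=
  Matrix.of fun u v => φ (Fin.cons (v 0) u) (Fin.tail v)

/-- The state after qubit number `0` of the right register has moved to the left one. -/
noncomputable def sendLeft {a b : ℕ} (φ : QAmp a (b + 1)) : QAmp (a + 1) b :=
  Matrix.of fun u v => φ (Fin.tail u) (Fin.cons (u 0) v)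

/-- The sender projects qubit `0` onto `⟨s|` and the receiver adjoins `|s⟩`; summing over `s` moves
the qubit. Each summand is a product of contractions local to the two parties. -/
theorem sendRight_eq_sum {a b : ℕ} (φ : QAmp (a + 1) b) :
    sendRight φ = ∑ s : Bool, qubitBra s a * φ * qubitBra s b := by
  ext u v
  simp only [Matrix.sum_apply, mul_qubitBra, qubitBra_mul, sendRight, Matrix.of_apply]
  simp

theorem sendLeft_eq_sum {a b : ℕ} (φ : QAmp a (b + 1)) :
    sendLeft φ = ∑ s : Bool, (qubitBra s a)ᴴ * φ * (qubitBra s b)ᴴ := by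
  ext u v
  simp only [Matrix.sum_apply, mul_qubitBra_conjTranspose, qubitBra_conjTranspose_mul, sendLeft,
    Matrix.of_apply]
  simp

theorem sum_qBits_succ {k : ℕ} (F : QBits (k + 1) → ℝ) :
    ∑ v, F v = ∑ s : Bool, ∑ v : QBits k, F (Fin.cons s v) := by
  rw [← Fintype.sum_prod_type', ← (Fin.consEquiv fun _ => Bool).sum_comp]
  rfl

theorem frobSq_sendRight {a b : ℕ} (φ : QAmp (a + 1) b) : frobSq (sendRight φ) = frobSq φ := by
  simp only [frobSq, sendRight, Matrix.of_apply, sum_qBits_succ, Fin.cons_zero, Fin.tail_cons]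
  exact Finset.sum_comm

theorem frobSq_sendLeft {a b : ℕ} (φ : QAmp a (b + 1)) : frobSq (sendLeft φ) = frobSq φ := by
  simp only [frobSq, sendLeft, Matrix.of_apply, sum_qBits_succ, Fin.cons_zero, Fin.tail_cons]
  exact Finset.sum_comm

end TransmittedQubit

/-! ### Expected value of an observable of the output. -/

namespace QProtocol

variable {X Y R : Type}

/-- The expectation of the observable `s` of the output. -/
noncomputable def expectation (x : X) (y : Y) (s : R → ℝ) :
    {a b : ℕ} → QProtocol X Y R a b → QAmp a b → ℝ
  | _, _, aliceOutputs _ V g, ψ => ∑ u, ∑ v, s (g x u) * ‖((V x).mat * ψ) u v‖ ^ 2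
  | _, _, bobOutputs _ V g, ψ => ∑ u, ∑ v, s (g y v) * ‖(ψ * (V y).matᵀ) u v‖ ^ 2
  | _, _, aliceSends _ U rest, ψ => expectation x y s rest (sendRight ((U x).mat * ψ))
  | _, _, bobSends _ U rest, ψ => expectation x y s rest (sendLeft (ψ * (U y).matᵀ))

open Classical in
theorem outputProb_eq_expectation (x : X) (y : Y) (r : R) {a b : ℕ} (P : QProtocol X Y R a b)
    (ψ : QAmp a b) :
    P.outputProb x y r ψ = P.expectation x y (fun r' => if r' = r then 1 else 0) ψ := by
  induction P with
  | aliceOutputs k V g => simp [outputProb, expectation]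
  | bobOutputs k V g => simp [outputProb, expectation]
  | aliceSends a' U rest ih => exact ih _
  | bobSends b' U rest ih => exact ih _

/-- Every step preserves the Frobenius norm, so the constant observable `1` has expectation `frobSq
ψ`. This converts success probabilities into correlations. -/
theorem expectation_affine (x : X) (y : Y) (s : R → ℝ) (c d : ℝ) {a b : ℕ}
    (P : QProtocol X Y R a b) (ψ : QAmp a b) :
    P.expectation x y (fun r => c * s r + d) ψ = c * P.expectation x y s ψ + d * frobSq ψ := by
  induction P with
  | aliceOutputs k V g =>
    rw [← frobSq_mul_of_isometry (V x).isometry ψ]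
    simp only [expectation, frobSq, add_mul, Finset.sum_add_distrib, Finset.mul_sum, mul_assoc]
  | bobOutputs k V g =>
    rw [← frobSq_mul_transpose_of_isometry (V y).isometry ψ]
    simp only [expectation, frobSq, add_mul, Finset.sum_add_distrib, Finset.mul_sum, mul_assoc]
  | aliceSends a' U rest ih =>
    rw [← frobSq_mul_of_isometry (U x).isometry ψ, ← frobSq_sendRight]
    exact ih _
  | bobSends b' U rest ih =>
    rw [← frobSq_mul_transpose_of_isometry (U y).isometry ψ, ← frobSq_sendLeft]
    exact ih _

theorem expectation_mono (x : X) (y : Y) {s t : R → ℝ} (h : ∀ r, s r ≤ t r) {a b : ℕ}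
    (P : QProtocol X Y R a b) (ψ : QAmp a b) :
    P.expectation x y s ψ ≤ P.expectation x y t ψ := by
  induction P with
  | aliceOutputs k V g =>
    exact Finset.sum_le_sum fun u _ => Finset.sum_le_sum fun v _ =>
      mul_le_mul_of_nonneg_right (h _) (by positivity)
  | bobOutputs k V g =>
    exact Finset.sum_le_sum fun u _ => Finset.sum_le_sum fun v _ =>
      mul_le_mul_of_nonneg_right (h _) (by positivity)
  | aliceSends a' U rest ih => exact ih _
  | bobSends b' U rest ih => exact ih _

/-- A protocol that computes `f` has correlation at least `1/3` with every `±1`-valued function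
of the value of `f`. -/
theorem Computes.one_third_le {a b : ℕ} {P : QProtocol X Y R a b} {ψ : QAmp a b}
    {f : X → Y → R} (hP : P.Computes ψ f) (hψ : frobSq ψ = 1) {s : R → ℝ}
    (hs : ∀ r, s r = 1 ∨ s r = -1) (x : X) (y : Y) :
    1 / 3 ≤ s (f x y) * P.expectation x y s ψ := by
  classical
  have hp := hP x y
  rw [outputProb_eq_expectation] at hp
  rcases hs (f x y) with h | h
  -- If `s (f x y) = 1`, then `s` dominates `2 · 1[r = f x y] - 1`, whose expectation is at least `2
  -- · 2/3 - 1 = 1/3`. The other sign is symmetric.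
  · have hm := P.expectation_mono x y (ψ := ψ) (t := s)
      (s := fun r => 2 * (if r = f x y then 1 else 0) + -1) (by
        intro r
        by_cases hr : r = f x y
        · subst hr; norm_num [h]
        · rcases hs r with h | h <;> norm_num [hr, h])
    rw [expectation_affine, hψ] at hm
    rw [h]; linarith
  · have hm := P.expectation_mono x y (ψ := ψ) (s := s)
      (t := fun r => -2 * (if r = f x y then 1 else 0) + 1) (by
        intro r
        by_cases hr : r = f x y
        · subst hr; norm_num [h]
        · rcases hs r with h | h <;> norm_num [hr, h])
    rw [expectation_affine, hψ] at hm
    rw [h]; linarith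

end QProtocol

/-! ### Correlation of a protocol with a sign matrix. -/

section CorrelationBound

open scoped Matrix.Norms.L2Operator

theorem l2_opNorm_mul_le_one {p q r : Type} [Fintype p] [Fintype q] [Fintype r] [DecidableEq p]
    [DecidableEq q] [DecidableEq r] {A : Matrix p q ℂ} {B : Matrix q r ℂ}
    (hA : ‖A‖ ≤ 1) (hB : ‖B‖ ≤ 1) : ‖A * B‖ ≤ 1 :=
  (Matrix.l2_opNorm_mul A B).trans (mul_le_one₀ hA (norm_nonneg _) hB)

theorem frobSq_mul_le_one {p q r : Type} [Fintype p] [Fintype q] [Fintype r]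
    [DecidableEq p] [DecidableEq q] [DecidableEq r] {A : Matrix p q ℂ} {ψ : Matrix q r ℂ}
    (hA : ‖A‖ ≤ 1) (hψ : frobSq ψ ≤ 1) : frobSq (A * ψ) ≤ 1 :=
  (frobSq_mul_le A ψ).trans
    (mul_le_one₀ (pow_le_one₀ (norm_nonneg _) hA) (frobSq_nonneg _) hψ)

theorem frobSq_mul_le_one' {p q r : Type} [Fintype p] [Fintype q] [Fintype r]
    [DecidableEq p] [DecidableEq q] [DecidableEq r] {A : Matrix q r ℂ} {ψ : Matrix p q ℂ}
    (hA : ‖A‖ ≤ 1) (hψ : frobSq ψ ≤ 1) : frobSq (ψ * A) ≤ 1 :=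
  (frobSq_mul_le' ψ A).trans
    (mul_le_one₀ (pow_le_one₀ (norm_nonneg _) hA) (frobSq_nonneg _) hψ)

variable {S T : Type} [Fintype S] [Fintype T] [DecidableEq S] [DecidableEq T]

/-- Expanding the quadratic form gives `card ι ^ 2` terms. Cyclicity of the trace gathers the
`x`-factors to the left of `ψ` and the `y`-factors to its right, so each term is an inner product
covered by `norm_sum_mul_inner_le`. `D` and `E` carry the final measurement. -/
theorem norm_sum_mul_trace_le {p p' q q' ι : Type} [Fintype p] [Fintype p'] [Fintype q]
    [Fintype q'] [Fintype ι] [DecidableEq p] [DecidableEq p'] [DecidableEq q] [DecidableEq q']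
    (H : Matrix S T ℂ) {ψ : Matrix p p' ℂ} (hψ : frobSq ψ ≤ 1)
    {A : ι → S → Matrix q p ℂ} {C : ι → T → Matrix p' q' ℂ}
    (hA : ∀ i x, ‖A i x‖ ≤ 1) (hC : ∀ i y, ‖C i y‖ ≤ 1)
    {D : S → Matrix q q ℂ} {E : T → Matrix q' q' ℂ} (hD : ∀ x, ‖D x‖ ≤ 1) (hE : ∀ y, ‖E y‖ ≤ 1) :
    ‖∑ x, ∑ y, H x y * ((∑ i, A i x * ψ * C i y)ᴴ * D x * (∑ i, A i x * ψ * C i y) * E y).trace‖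
      ≤ Fintype.card ι ^ 2 * (‖H‖ * √(Fintype.card S * Fintype.card T)) := by
  have key : ∀ i j, ‖∑ x, ∑ y, H x y *
      ((((A i x)ᴴ * D x * A j x)ᴴ * ψ)ᴴ * (ψ * (C j y * E y * (C i y)ᴴ))).trace‖ ≤
      ‖H‖ * √(Fintype.card S * Fintype.card T) := by
    intro i j
    refine abs_le_of_sq_le_sq' ?_ (by positivity) |>.2
    rw [mul_pow, Real.sq_sqrt (by positivity)]
    refine norm_sum_mul_inner_le H _ _ (fun x => ?_) (fun y => ?_)
    · refine frobSq_mul_le_one ?_ hψ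
      rw [Matrix.l2_opNorm_conjTranspose]
      refine l2_opNorm_mul_le_one (l2_opNorm_mul_le_one ?_ (hD x)) (hA j x)
      rw [Matrix.l2_opNorm_conjTranspose]
      exact hA i x
    · refine frobSq_mul_le_one' ?_ hψ
      refine l2_opNorm_mul_le_one (l2_opNorm_mul_le_one (hC j y) (hE y)) ?_
      rw [Matrix.l2_opNorm_conjTranspose]
      exact hC i y
  have hexp : ∑ x, ∑ y, H x y *
      ((∑ i, A i x * ψ * C i y)ᴴ * D x * (∑ i, A i x * ψ * C i y) * E y).trace =
      ∑ i, ∑ j, ∑ x, ∑ y, H x y *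
      ((((A i x)ᴴ * D x * A j x)ᴴ * ψ)ᴴ * (ψ * (C j y * E y * (C i y)ᴴ))).trace := by
    have h1 : ∀ x y, ((∑ i, A i x * ψ * C i y)ᴴ * D x * (∑ i, A i x * ψ * C i y) * E y).trace =
        ∑ i, ∑ j,
          ((((A i x)ᴴ * D x * A j x)ᴴ * ψ)ᴴ * (ψ * (C j y * E y * (C i y)ᴴ))).trace := by
      intro x y
      simp only [Matrix.conjTranspose_sum, Matrix.sum_mul, Matrix.mul_sum, Matrix.trace_sum]
      rw [Finset.sum_comm]
      refine Finset.sum_congr rfl fun i _ => Finset.sum_congr rfl fun j _ => ?_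
      simp only [Matrix.conjTranspose_mul, Matrix.conjTranspose_conjTranspose, Matrix.mul_assoc]
      rw [Matrix.trace_mul_comm]
      simp only [Matrix.mul_assoc]
    simp only [h1, Finset.mul_sum]
    rw [Finset.sum_congr rfl fun x _ => Finset.sum_comm, Finset.sum_comm]
    refine Finset.sum_congr rfl fun i _ => ?_
    rw [Finset.sum_congr rfl fun x _ => Finset.sum_comm, Finset.sum_comm]
  rw [hexp]
  calc _ ≤ ∑ i : ι, ∑ j : ι, ‖H‖ * √(Fintype.card S * Fintype.card T) :=
        norm_sum_le_of_le _ fun i _ => norm_sum_le_of_le _ fun j _ => key i j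
    _ = _ := by simp [sq, mul_assoc]

theorem l2_opNorm_diagonal_ofReal_le_one {q : Type} [Fintype q] [DecidableEq q] {w : q → ℝ}
    (hw : ∀ u, |w u| ≤ 1) : ‖Matrix.diagonal fun u => (w u : ℂ)‖ ≤ 1 := by
  rw [Matrix.l2_opNorm_diagonal]
  exact (pi_norm_le_iff_of_nonneg zero_le_one).2 fun u => by simpa using hw u

theorem l2_opNorm_one_le_one {q : Type} [Fintype q] [DecidableEq q] :
    ‖(1 : Matrix q q ℂ)‖ ≤ 1 :=
  l2_opNorm_le_one_of_isometry (by simp)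

theorem sum_left_weight_eq_trace {p q : Type} [Fintype p] [Fintype q] [DecidableEq p]
    [DecidableEq q] (w : p → ℝ) (φ : Matrix p q ℂ) :
    ((∑ u, ∑ v, w u * ‖φ u v‖ ^ 2 : ℝ) : ℂ) =
      (φᴴ * Matrix.diagonal (fun u => (w u : ℂ)) * φ * (1 : Matrix q q ℂ)).trace := by
  rw [Matrix.mul_one, Finset.sum_comm, Matrix.mul_assoc]
  simp only [Matrix.trace, Matrix.diag, Matrix.mul_apply (M := φᴴ), Matrix.diagonal_mul,
    Matrix.conjTranspose_apply, Complex.ofReal_sum, Complex.ofReal_mul, Complex.ofReal_pow]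
  refine Finset.sum_congr rfl fun v _ => Finset.sum_congr rfl fun u _ => ?_
  rw [← Complex.conj_mul', starRingEnd_apply]
  ring

theorem sum_right_weight_eq_trace {p q : Type} [Fintype p] [Fintype q] [DecidableEq p]
    [DecidableEq q] (w : q → ℝ) (φ : Matrix p q ℂ) :
    ((∑ u, ∑ v, w v * ‖φ u v‖ ^ 2 : ℝ) : ℂ) =
      (φᴴ * (1 : Matrix p p ℂ) * φ * Matrix.diagonal (fun u => (w u : ℂ))).trace := by
  rw [Matrix.mul_one, Finset.sum_comm, Matrix.mul_assoc]
  simp only [Matrix.trace, Matrix.diag, Matrix.mul_apply (M := φᴴ), Matrix.mul_diagonal,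
    Matrix.conjTranspose_apply, Complex.ofReal_sum, Complex.ofReal_mul, Complex.ofReal_pow]
  refine Finset.sum_congr rfl fun v _ => Finset.sum_congr rfl fun u _ => ?_
  rw [← Complex.conj_mul', starRingEnd_apply]
  ring

/-- Every bounded observable of the output of a protocol has `γ₂`-norm at most `4 ^ cost`. -/
theorem QProtocol.norm_sum_mul_expectation_le {X Y R : Type} (H : Matrix S T ℂ) (e : S → X)
    (e' : T → Y) {s : R → ℝ} (hs : ∀ r, |s r| ≤ 1) {a₀ b₀ : ℕ} {ψ : QAmp a₀ b₀}
    (hψ : frobSq ψ ≤ 1) {a b : ℕ} (P : QProtocol X Y R a b) :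
    ∀ {ι : Type} [Fintype ι] (A : ι → S → Matrix (QBits a) (QBits a₀) ℂ)
      (C : ι → T → Matrix (QBits b₀) (QBits b) ℂ),
      (∀ i x, ‖A i x‖ ≤ 1) → (∀ i y, ‖C i y‖ ≤ 1) →
      ‖∑ x, ∑ y, H x y * (P.expectation (e x) (e' y) s (∑ i, A i x * ψ * C i y) : ℂ)‖ ≤
        Fintype.card ι ^ 2 * 4 ^ P.cost * (‖H‖ * √(Fintype.card S * Fintype.card T)) := by
  -- The initial `ψ` stays fixed; `ι` indexes the strings of qubit values sent so far. A message
  -- replaces `ι` by `ι × Bool`, which multiplies `card ι ^ 2` by `4`.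
  induction P with
  | aliceOutputs k V g =>
    intro ι _ A C hA hC
    have h := norm_sum_mul_trace_le H hψ (A := fun i x => (V (e x)).mat * A i x) (C := C)
      (D := fun x => Matrix.diagonal fun u => (s (g (e x) u) : ℂ)) (E := fun _ => 1)
      (fun i x => l2_opNorm_mul_le_one (l2_opNorm_le_one_of_isometry (V (e x)).isometry) (hA i x))
      hC (fun x => l2_opNorm_diagonal_ofReal_le_one fun u => hs _) (fun _ => l2_opNorm_one_le_one)
    simp only [← sum_left_weight_eq_trace] at h
    simpa only [expectation, cost, pow_zero, mul_one, Matrix.mul_sum, Matrix.mul_assoc] using h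
  | bobOutputs k V g =>
    intro ι _ A C hA hC
    have h := norm_sum_mul_trace_le H hψ (A := A) (C := fun i y => C i y * (V (e' y)).matᵀ)
      (D := fun _ => 1) (E := fun y => Matrix.diagonal fun u => (s (g (e' y) u) : ℂ)) hA
      (fun i y => l2_opNorm_mul_le_one (hC i y)
        (l2_opNorm_transpose_le_one_of_isometry (V (e' y)).isometry))
      (fun _ => l2_opNorm_one_le_one) (fun x => l2_opNorm_diagonal_ofReal_le_one fun u => hs _)
    simp only [← sum_right_weight_eq_trace] at h
    simpa only [expectation, cost, pow_zero, mul_one, Matrix.sum_mul, Matrix.mul_assoc] using h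
  | @aliceSends _ b a' U rest ih =>
    intro ι _ A C hA hC
    have h := ih (ι := ι × Bool)
      (fun i x => qubitBra i.2 a' * ((U (e x)).mat * A i.1 x)) (fun i y => C i.1 y * qubitBra i.2 b)
      (fun i x => l2_opNorm_mul_le_one
        (l2_opNorm_le_one_of_coisometry (qubitBra_coisometry _ _))
        (l2_opNorm_mul_le_one (l2_opNorm_le_one_of_isometry (U (e x)).isometry) (hA _ x)))
      (fun i y => l2_opNorm_mul_le_one (hC _ y)
        (l2_opNorm_le_one_of_coisometry (qubitBra_coisometry _ _)))
    have hst : ∀ x y, sendRight ((U (e x)).mat * ∑ i, A i x * ψ * C i y) =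
        ∑ i : ι × Bool, qubitBra i.2 a' * ((U (e x)).mat * A i.1 x) * ψ *
          (C i.1 y * qubitBra i.2 b) := by
      intro x y
      rw [sendRight_eq_sum, Fintype.sum_prod_type, Finset.sum_comm]
      simp only [Matrix.sum_mul, Matrix.mul_sum, Matrix.mul_assoc]
    simp only [← hst] at h
    refine h.trans_eq ?_
    simp only [cost, Fintype.card_prod, Fintype.card_bool, Nat.cast_mul, Nat.cast_ofNat]
    ring
  | @bobSends a _ b' U rest ih =>
    intro ι _ A C hA hC
    have hket : ∀ s k, ‖(qubitBra s k)ᴴ‖ ≤ 1 := fun s k => by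
      rw [Matrix.l2_opNorm_conjTranspose]
      exact l2_opNorm_le_one_of_coisometry (qubitBra_coisometry _ _)
    have h := ih (ι := ι × Bool)
      (fun i x => (qubitBra i.2 a)ᴴ * A i.1 x)
      (fun i y => C i.1 y * (U (e' y)).matᵀ * (qubitBra i.2 b')ᴴ)
      (fun i x => l2_opNorm_mul_le_one (hket _ _) (hA _ x))
      (fun i y => l2_opNorm_mul_le_one (l2_opNorm_mul_le_one (hC _ y)
        (l2_opNorm_transpose_le_one_of_isometry (U (e' y)).isometry)) (hket _ _))
    have hst : ∀ x y, sendLeft ((∑ i, A i x * ψ * C i y) * (U (e' y)).matᵀ) =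
        ∑ i : ι × Bool, (qubitBra i.2 a)ᴴ * A i.1 x * ψ *
          (C i.1 y * (U (e' y)).matᵀ * (qubitBra i.2 b')ᴴ) := by
      intro x y
      rw [sendLeft_eq_sum, Fintype.sum_prod_type, Finset.sum_comm]
      simp only [Matrix.sum_mul, Matrix.mul_sum, Matrix.mul_assoc]
    simp only [← hst] at h
    refine h.trans_eq ?_
    simp only [cost, Fintype.card_prod, Fintype.card_bool, Nat.cast_mul, Nat.cast_ofNat]
    ring

/-- A sign matrix `H` that occurs in the communication matrix of `f`, up to a map of the values,
bounds the cost of computing `f`. -/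
theorem QProtocol.Computes.card_mul_card_le {X Y R : Type} {a b : ℕ} {P : QProtocol X Y R a b}
    {ψ : QAmp a b} {f : X → Y → R} (hP : P.Computes ψ f) (hψ : frobSq ψ = 1) {s : R → ℝ}
    (hs : ∀ r, s r = 1 ∨ s r = -1) (e : S → X) (e' : T → Y) (H : Matrix S T ℂ)
    (hH : ∀ x y, H x y = (s (f (e x) (e' y)) : ℂ)) :
    (Fintype.card S * Fintype.card T : ℝ) ≤ 9 * 16 ^ P.cost * ‖H‖ ^ 2 := by
  have h := P.norm_sum_mul_expectation_le H e e' (s := s)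
    (fun r => by rcases hs r with h | h <;> simp [h]) hψ.le (ι := Unit) (fun _ _ => 1)
    (fun _ _ => 1) (fun _ _ => l2_opNorm_one_le_one) (fun _ _ => l2_opNorm_one_le_one)
  simp only [Matrix.one_mul, Matrix.mul_one, Finset.univ_unique, Finset.sum_singleton,
    Fintype.card_unit, Nat.cast_one, one_pow, one_mul, hH, ← Complex.ofReal_mul,
    ← Complex.ofReal_sum, Complex.norm_real, Real.norm_eq_abs] at h
  set K : ℝ := Fintype.card S * Fintype.card T with hK
  have hK0 : 0 ≤ K := by positivity
  have hlow : K / 3 ≤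
      ∑ x, ∑ y, s (f (e x) (e' y)) * P.expectation (e x) (e' y) s ψ := by
    calc K / 3 = ∑ _x : S, ∑ _y : T, (1 / 3 : ℝ) := by simp [hK]; ring
      _ ≤ _ := Finset.sum_le_sum fun x _ => Finset.sum_le_sum fun y _ =>
        hP.one_third_le hψ hs _ _
  -- Squaring gives `K² / 9 ≤ 16 ^ cost * ‖H‖² * K`; one factor `K` is then cancelled, with `K = 0`
  -- apart.
  have h2 := pow_le_pow_left₀ (by positivity) (hlow.trans ((le_abs_self _).trans h)) 2
  rw [mul_pow, mul_pow, Real.sq_sqrt hK0, ← pow_mul, mul_comm _ 2, pow_mul] at h2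
  norm_num at h2
  rcases hK0.eq_or_lt with h0 | h0
  · rw [← h0]; positivity
  · refine le_of_mul_le_mul_right ?_ h0
    nlinarith

end CorrelationBound

/-! ### The Hadamard matrix and the inner product mod 2. -/

section InnerProduct

open scoped Matrix.Norms.L2Operator

/-- The Hadamard matrix of the inner product modulo `2` of bit strings indexed by `κ`. -/
noncomputable def innerProductSign (κ : Type) [Fintype κ] : Matrix (κ → Bool) (κ → Bool) ℂ :=
  Matrix.of fun x y => ∏ i, if x i && y i then -1 else 1

variable (κ : Type) [Fintype κ] [DecidableEq κ]

/-- The sum over `x` factors over coordinates: one contributes `2` where `y` and `z` agree and `1 -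
1 = 0` where they differ. -/
theorem innerProductSign_conjTranspose_mul_self :
    (innerProductSign κ)ᴴ * innerProductSign κ = (2 ^ Fintype.card κ : ℂ) • 1 := by
  ext y z
  have h : ∀ x : κ → Bool, star (innerProductSign κ x y) * innerProductSign κ x z =
      ∏ i, ((if x i && y i then -1 else 1) * (if x i && z i then -1 else 1) : ℂ) := by
    intro x
    simp only [innerProductSign, Matrix.of_apply, star_prod, Finset.prod_mul_distrib,
      apply_ite star, star_neg, star_one]
  simp only [Matrix.mul_apply, Matrix.conjTranspose_apply, h]
  rw [← Fintype.prod_sum fun i (c : Bool) =>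
    ((if c && y i then -1 else 1) * (if c && z i then -1 else 1) : ℂ)]
  have h2 : ∀ i, (∑ c : Bool,
      ((if c && y i then -1 else 1) * (if c && z i then -1 else 1) : ℂ)) =
      if y i = z i then 2 else 0 := by
    intro i
    cases y i <;> cases z i <;> norm_num
  simp only [h2, Matrix.smul_apply, Matrix.one_apply, smul_eq_mul]
  by_cases hyz : y = z
  · simp [hyz]
  · obtain ⟨i, hi⟩ := Function.ne_iff.1 hyz
    rw [if_neg hyz, mul_zero]
    exact Finset.prod_eq_zero (Finset.mem_univ i) (if_neg hi)

theorem l2_opNorm_innerProductSign_sq_le :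
    ‖innerProductSign κ‖ ^ 2 ≤ 2 ^ Fintype.card κ := by
  rw [sq, ← Matrix.l2_opNorm_conjTranspose_mul_self, innerProductSign_conjTranspose_mul_self,
    norm_smul, norm_pow, Complex.norm_ofNat]
  exact mul_le_of_le_one_right (by positivity) l2_opNorm_one_le_one

variable {κ}

theorem QProtocol.Computes.card_le_of_innerProduct {X Y R : Type} {a b : ℕ}
    {P : QProtocol X Y R a b} {ψ : QAmp a b} {f : X → Y → R} (hP : P.Computes ψ f)
    (hψ : frobSq ψ = 1) {s : R → ℝ} (hs : ∀ r, s r = 1 ∨ s r = -1)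
    (e : (κ → Bool) → X) (e' : (κ → Bool) → Y)
    (h : ∀ x y, s (f (e x) (e' y)) = ∏ i, if x i && y i then -1 else 1) :
    Fintype.card κ ≤ 4 * P.cost + 4 := by
  have h1 := hP.card_mul_card_le hψ hs e e' (innerProductSign κ) (fun x y => by
    rw [h]
    simp [innerProductSign, apply_ite Complex.ofReal])
  have h2 : (2 : ℝ) ^ Fintype.card κ * 2 ^ Fintype.card κ ≤
      2 ^ (4 * P.cost + 4) * 2 ^ Fintype.card κ := by
    calc _ = (Fintype.card (κ → Bool) * Fintype.card (κ → Bool) : ℝ) := by simp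
      _ ≤ _ := h1
      -- Rounding `9` up to `2 ^ 4` is the source of the additive `4`.
      _ ≤ 16 * 16 ^ P.cost * 2 ^ Fintype.card κ := by
        gcongr
        · norm_num
        · exact l2_opNorm_innerProductSign_sq_le κ
      _ = _ := by rw [pow_add, pow_mul]; norm_num; ring
  have h3 := le_of_mul_le_mul_right h2 (by positivity)
  exact (pow_le_pow_iff_right₀ one_lt_two).1 h3

end InnerProduct

/-! ### Embedding the inner product into a determinant. -/

section Determinant

/-- The Boolean block matrix `[[1, [z, 0]], [[0; 1], [[1, 1], [0, 0]]]]`, padded by an identity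
block; its determinant is the number of ones of `z`. -/
def sumGadget (m r : ℕ) (z : Fin m × Fin m → Bool) :
    Matrix ((Fin m ⊕ (Fin m ⊕ Unit)) ⊕ Fin r) ((Fin m ⊕ (Fin m ⊕ Unit)) ⊕ Fin r) Bool :=
  Matrix.fromBlocks
    (Matrix.fromBlocks (Matrix.of fun i j => decide (i = j))
      (Matrix.fromCols (Matrix.of fun i j => z (i, j)) (Matrix.of fun _ _ => false))
      (Matrix.fromRows (Matrix.of fun _ _ => false) (Matrix.of fun _ _ => true))
      (Matrix.fromBlocks (Matrix.of fun i j => decide (i = j)) (Matrix.of fun _ _ => true)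
        (Matrix.of fun _ _ => false) (Matrix.of fun _ _ => false)))
    (Matrix.of fun _ _ => false) (Matrix.of fun _ _ => false)
    (Matrix.of fun i j => decide (i = j))

/-- Entries outside the `z` block are the same constants in both matrices, and AND is idempotent. -/
theorem sumGadget_and (m r : ℕ) (x y : Fin m × Fin m → Bool) (i j) :
    (sumGadget m r x i j && sumGadget m r y i j) = sumGadget m r (fun k => x k && y k) i j := by
  rcases i with (i | i | i) | i <;> rcases j with (j | j | j) | j <;> simp [sumGadget]

/-- Two Schur complements against identity blocks leave the `1 × 1` matrix `row * Z * col`, the sum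
of the entries of `Z`. -/
theorem det_sumGadget (m r : ℕ) (z : Fin m × Fin m → Bool) :
    ((sumGadget m r z).map fun b => if b then (1 : ℤ) else 0).det =
      ∑ k, if z k then 1 else 0 := by
  let Z : Matrix (Fin m) (Fin m) ℤ := Matrix.of fun i j => if z (i, j) then 1 else 0
  let col : Matrix (Fin m) Unit ℤ := Matrix.of fun _ _ => 1
  let row : Matrix Unit (Fin m) ℤ := Matrix.of fun _ _ => 1
  have hmat : (sumGadget m r z).map (fun b => if b then (1 : ℤ) else 0) =
      Matrix.fromBlocks
        (Matrix.fromBlocks 1 (Matrix.fromCols Z 0) (Matrix.fromRows 0 row)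
          (Matrix.fromBlocks 1 col 0 0))
        0 0 1 := by
    ext i j
    rcases i with (i | i | i) | i <;> rcases j with (j | j | j) | j <;>
      simp [sumGadget, Matrix.one_apply, Z, col, row]
    rfl
  rw [hmat, Matrix.det_fromBlocks_zero₂₁, Matrix.det_one, mul_one, Matrix.det_fromBlocks_one₁₁]
  have hsub : Matrix.fromBlocks 1 col 0 0 - Matrix.fromRows 0 row * Matrix.fromCols Z 0 =
      Matrix.fromBlocks 1 col (-(row * Z)) 0 := by
    ext i j
    rcases i with i | i <;> rcases j with j | j <;> simp [Matrix.mul_apply]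
  rw [hsub, Matrix.det_fromBlocks_one₁₁, Matrix.det_unique]
  simp only [Matrix.neg_mul, zero_sub, neg_neg, Matrix.mul_apply, Z, col, row, Matrix.of_apply,
    mul_one, one_mul]
  rw [Fintype.sum_prod_type, Finset.sum_comm]

theorem exists_detAnd_eq_sum {m n : ℕ} (h : 2 * m + 1 ≤ n) :
    ∃ e : (Fin m × Fin m → Bool) → Matrix (Fin n) (Fin n) Bool,
      ∀ x y, detAnd n (e x) (e y) = ∑ k, if x k && y k then 1 else 0 := by
  obtain ⟨r, rfl⟩ := Nat.exists_eq_add_of_le h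
  -- Any bijection serves: using the same `σ` on rows and columns leaves the determinant unchanged.
  let σ : Fin (2 * m + 1 + r) ≃ (Fin m ⊕ (Fin m ⊕ Unit)) ⊕ Fin r :=
    Fintype.equivOfCardEq (by simp; ring)
  refine ⟨fun z => (sumGadget m r z).submatrix σ σ, fun x y => ?_⟩
  rw [← det_sumGadget m r fun k => x k && y k, ← Matrix.det_submatrix_equiv_self σ, detAnd]
  congr 1
  ext i j
  simp only [Matrix.of_apply, Matrix.submatrix_apply, Matrix.map_apply, sumGadget_and]

end Determinant

/-! ### Parity signs, constants and the conclusion. -/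

theorem prod_neg_one_eq_ite_even {κ : Type} [Fintype κ] (z : κ → Bool) :
    (∏ k, if z k then (-1 : ℝ) else 1) =
      if (∑ k, if z k then (1 : ℤ) else 0) ≡ 0 [ZMOD 2] then 1 else -1 := by
  have h1 : (∏ k, if z k then (-1 : ℝ) else 1) = (-1) ^ (∑ k, if z k then 1 else 0) := by
    rw [← Finset.prod_pow_eq_pow_sum]
    exact Finset.prod_congr rfl fun k _ => by cases z k <;> simp
  have h2 : (∑ k, if z k then (1 : ℤ) else 0) = ((∑ k, if z k then 1 else 0 : ℕ) : ℤ) := by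
    push_cast
    rfl
  rw [h1, h2]
  generalize (∑ k, if z k then 1 else 0 : ℕ) = t
  rcases Nat.even_or_odd t with ht | ht
  · rw [ht.neg_one_pow, if_pos]
    rw [Int.modEq_zero_iff_dvd]
    exact_mod_cast ht.two_dvd
  · rw [ht.neg_one_pow, if_neg]
    rw [Int.modEq_zero_iff_dvd]
    have := ht.not_two_dvd_nat
    exact_mod_cast this

theorem sq_le_cost_of_sign {n : ℕ} (hn : 12 ≤ n) {R : Type}
    {f : Matrix (Fin n) (Fin n) Bool → Matrix (Fin n) (Fin n) Bool → R} {s : R → ℝ}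
    (hs : ∀ r, s r = 1 ∨ s r = -1)
    (hf : ∀ x y, s (f x y) = if detAnd n x y ≡ 0 [ZMOD 2] then 1 else -1)
    {a b : ℕ} {P : QProtocol _ _ R a b} {ψ : QAmp a b} (hψ : ∑ u, ∑ v, ‖ψ u v‖ ^ 2 = 1)
    (hP : P.Computes ψ f) : n ^ 2 ≤ 128 * P.cost := by
  obtain ⟨m, hm, hm'⟩ : ∃ m, 2 * m + 1 ≤ n ∧ n ≤ 2 * m + 2 := ⟨(n - 1) / 2, by omega, by omega⟩
  obtain ⟨e, he⟩ := exists_detAnd_eq_sum hm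
  have h := hP.card_le_of_innerProduct hψ hs e e fun x y => by
    rw [hf, he, prod_neg_one_eq_ite_even fun k => x k && y k]
  simp only [Fintype.card_prod, Fintype.card_fin] at h
  -- Here `m * m ≤ 4 * P.cost + 4` and `n ≤ 2 * m + 2`; `12 ≤ n` gives `m ≥ 5`, which absorbs the
  -- additive terms. The constant `128` is not optimal.
  nlinarith

theorem mul_sq_le_quantumCCEntangled {n : ℕ} (hn : 12 ≤ n) {R : Type}
    {f : Matrix (Fin n) (Fin n) Bool → Matrix (Fin n) (Fin n) Bool → R} {s : R → ℝ}
    (hs : ∀ r, s r = 1 ∨ s r = -1)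
    (hf : ∀ x y, s (f x y) = if detAnd n x y ≡ 0 [ZMOD 2] then 1 else -1) :
    ((128⁻¹ : ℝ≥0) : ℝ≥0∞) * (n : ℝ≥0∞) ^ 2 ≤ (quantumCCEntangled f : ℝ≥0∞) := by
  -- The infimum lives in `ℕ∞`, so `n ^ 2 / 128` is rounded up to a natural number.
  have h : (((n ^ 2 + 127) / 128 : ℕ) : ℕ∞) ≤ quantumCCEntangled f := by
    refine le_iInf fun a => le_iInf fun b => le_iInf fun ψ => le_iInf fun hψ =>
      le_iInf fun P => le_iInf fun hP => ?_
    have := sq_le_cost_of_sign hn hs hf hψ hP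
    exact_mod_cast (by omega : (n ^ 2 + 127) / 128 ≤ P.cost)
  have h' := ENat.toENNReal_le.2 h
  refine le_trans ?_ h'
  have h2 : n ^ 2 ≤ 128 * ((n ^ 2 + 127) / 128) := by omega
  generalize (n ^ 2 + 127) / 128 = t at h2 ⊢
  have h3 : (128⁻¹ : ℝ≥0) * (n : ℝ≥0) ^ 2 ≤ (t : ℝ≥0) := by
    rw [inv_mul_le_iff₀ (by norm_num)]
    exact_mod_cast h2
  rw [ENat.toENNReal_coe]
  exact_mod_cast h3

/-- The start without qubits is the case `a = b = 0` of a shared unit vector. -/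
theorem quantumCCEntangled_le_quantumCC {X Y R : Type} (f : X → Y → R) :
    quantumCCEntangled f ≤ quantumCC f :=
  le_iInf fun P => le_iInf fun hP => iInf_le_of_le 0 <| iInf_le_of_le 0 <|
    iInf_le_of_le (Matrix.of fun _ _ => 1) <| iInf_le_of_le (by simp) <|
      iInf_le_of_le P <| iInf_le _ hP

theorem mainTheorem5 :
    ∃ c : ℝ≥0, 0 < c ∧ ∃ N : ℕ, ∀ n : ℕ, N ≤ n →
      (c : ℝ≥0∞) * (n : ℝ≥0∞) ^ 2 ≤ (quantumCC (detAnd n) : ℝ≥0∞) ∧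
      (c : ℝ≥0∞) * (n : ℝ≥0∞) ^ 2 ≤ (quantumCC (detAndEven n) : ℝ≥0∞) ∧
      (c : ℝ≥0∞) * (n : ℝ≥0∞) ^ 2 ≤ (quantumCCEntangled (detAnd n) : ℝ≥0∞) ∧
      (c : ℝ≥0∞) * (n : ℝ≥0∞) ^ 2 ≤ (quantumCCEntangled (detAndEven n) : ℝ≥0∞) := by
  refine ⟨128⁻¹, by positivity, 12, fun n hn => ?_⟩
  -- The sign `s` reads only the parity of the output, so the integer problem and the parity problem
  -- share one bound.
  have h1 := mul_sq_le_quantumCCEntangled hn (f := detAnd n)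
    (s := fun r => if r ≡ 0 [ZMOD 2] then 1 else -1)
    (fun r => by by_cases h : r ≡ 0 [ZMOD 2] <;> simp [h]) (fun x y => rfl)
  have h2 := mul_sq_le_quantumCCEntangled hn (f := detAndEven n)
    (s := fun r => if r then 1 else -1) (fun r => by cases r <;> simp)
    (fun x y => by simp [detAndEven])
  exact ⟨h1.trans (ENat.toENNReal_le.2 (quantumCCEntangled_le_quantumCC _)),
    h2.trans (ENat.toENNReal_le.2 (quantumCCEntangled_le_quantumCC _)), h1, h2⟩
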